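/- Let $X$ be a real separable Hilbert space. Let $\{U(t,s)\}_{s\le t}\subseteq\mathcal L(X)$ be a strongly continuous evolution operator: for every $x\in X$ the map $(s,t)\mapsto U(t,s)x$ is continuous on $\{(s,t)\in\mathbb R^2: s\le t\}$, $U(t,t)=I$, $U(t,r)U(r,s)=U(t,s)$ for $s\le r\le t$, and there are $M>0$, $\zeta\in\mathbb R$ with $\|U(t,s)\|\le Me^{-\zeta(t-s)}$ for $s\le t$. Let $\{B(t)\}_{t\in\mathbb R}\subseteq\mathcal L(X)$ satisfy $\sup_{t}\|B(t)\|<\infty$, with $t\mapsto B(t)x$ continuous for every $x\in X$. Put $Q(r)=B(r)B(r)^\star$ and, for $s<t$, $$Q(t,s)=\int_s^t U(t,r)Q(r)U(t,r)^\star\,dr$$ (integrals of operators are understood strongly, i.e. applied to each $x\in X$), and assume that $Q(t,s)$ has finite trace for all $s<t$. For $m\in X$ and a non-negative self-adjoint trace class operator $Q$ let $\mathcal N_{m,Q}$ be the Gaussian measure on $X$ with mean $m$ and covariance $Q$, i.e. the Borel probability measure with characteristic function $h\mapsto e^{i\langle m,h\rangle-\frac12\langle Qh,h\rangle}$. For $s\le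 t$ define $$P_{s,s}\varphi=\varphi,\qquad P_{s,t}\varphi(x)=\int_X\varphi(y)\,\mathcal N_{U(t,s)x,\,Q(t,s)}(dy)\quad(s<t),\qquad V_{s,t}\varphi(x)=\varphi(U(t,s)x).$$ An evolution system of measures for a family $\{R_{s,t}\}_{s\le t}$ of such operators is a family $\{\nu_t\}_{t\in\mathbb R}$ of Borel probability measures on $X$ with $\int_X R_{s,t}\varphi\,d\nu_s=\int_X\varphi\,d\nu_t$ for all $s\le t$ and all bounded continuous $\varphi:X\to\mathbb R$. Theorem. Assume that for every $t\in\mathbb R$ $$\sup_{s<t}\operatorname{Tr}Q(t,s)<+\infty .$$ Then: 1. For every $t\in\mathbb R$ the operator $Q(t,-\infty)=\int_{-\infty}^tU(t,r)Q(r)U(t,r)^\star\,dr$ is well defined (for every $x\in X$ the function $r\mapsto U(t,r)Q(r)U(t,r)^\star x$ is integrable on $(-\infty,t]$, and the integral defines a bounded operator), and it is self-adjoint, non-negative and of finite trace. 2. The measures $\gamma_t=\mathcal N_{0,\,Q(t,-\infty)}$, $t\in\mathbb R$, form an evolution system of measures for $\{P_{s,t}\}_{s\le t}$. 3. A family $\{\nu_t\}_{t\in\mathbb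 R}$ of Borel measures on $X$ is an evolution system of measures for $\{P_{s,t}\}_{s\le t}$ if and only if there is an evolution system of measures $\{\mu_t\}_{t\in\mathbb R}$ for $\{V_{s,t}\}_{s\le t}$ such that $\nu_t=\gamma_t\star\mu_t$ for every $t\in\mathbb R$. -/

import Mathlib

open MeasureTheory Set
open scoped ENNReal BoundedContinuousFunction InnerProductSpace

universe u

noncomputable section

/-! ### Trace of a non-negative operator -/

section Trace

variable {X : Type*} [NormedAddCommGroup X] [InnerProductSpace ℝ X]

/-- `∑ᵢ ⟨T eᵢ, eᵢ⟩` along the orthonormal basis `e`, with values in `[0, ∞]`. It is only used for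
non-negative self-adjoint `T`, for which the truncation `ENNReal.ofReal` changes nothing. -/
def traceAlong {ι : Type*} (e : HilbertBasis ι ℝ X) (T : X →L[ℝ] X) : ℝ≥0∞ :=
  ∑' i, ENNReal.ofReal ⟪T (e i), e i⟫_ℝ

/-- The trace of a non-negative self-adjoint operator on a Hilbert space, computed along some
orthonormal basis; `opTrace_eq_traceAlong` shows that the choice of the basis is irrelevant. -/
def opTrace [CompleteSpace X] (T : X →L[ℝ] X) : ℝ≥0∞ :=
  traceAlong (exists_hilbertBasis ℝ X).choose_spec.choose T

/-- A positive semidefinite form is the pull-back of the inner product of some Hilbert space. -/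
theorem exists_hilbert_of_core {V : Type u} [AddCommGroup V] [Module ℝ V]
    (c : PreInnerProductSpace.Core ℝ V) :
    ∃ (K : Type u) (_ : NormedAddCommGroup K) (_ : InnerProductSpace ℝ K) (_ : CompleteSpace K)
      (j : V →ₗ[ℝ] K), ∀ x y, ⟪j x, j y⟫_ℝ = c.inner x y := by
  let _ : SeminormedAddCommGroup V := InnerProductSpace.Core.toSeminormedAddCommGroup (𝕜 := ℝ)
  let _ : InnerProductSpace ℝ V := InnerProductSpace.ofCore c
  exact ⟨UniformSpace.Completion V, inferInstance, inferInstance, inferInstance,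
    (UniformSpace.Completion.toComplₗᵢ (𝕜 := ℝ) (E := V)).toLinearMap,
    fun x y => UniformSpace.Completion.inner_coe x y⟩

theorem tsum_ofReal_sq_inner {ι : Type*} (e : HilbertBasis ι ℝ X) (x : X) :
    ∑' i, ENNReal.ofReal (⟪x, e i⟫_ℝ ^ 2) = ENNReal.ofReal (‖x‖ ^ 2) := by
  have h := e.hasSum_inner_mul_inner x x
  have h' : HasSum (fun i => ⟪x, e i⟫_ℝ ^ 2) (‖x‖ ^ 2) := by
    rw [← real_inner_self_eq_norm_sq]
    refine h.congr_fun ?_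
    intro i
    rw [real_inner_comm x (e i), sq]
  rw [← h'.tsum_eq, ENNReal.ofReal_tsum_of_nonneg (fun i => sq_nonneg _) h'.summable]

theorem traceAlong_eq_of_factor [CompleteSpace X] {K : Type*} [NormedAddCommGroup K]
    [InnerProductSpace ℝ K] [CompleteSpace K] {ι κ : Type*} (e : HilbertBasis ι ℝ X)
    (k : HilbertBasis κ ℝ K) {T : X →L[ℝ] X} {j : X →L[ℝ] K}
    (hj : ∀ x, ‖j x‖ ^ 2 = ⟪T x, x⟫_ℝ) :
    traceAlong e T = ∑' m, ENNReal.ofReal (‖ContinuousLinearMap.adjoint j (k m)‖ ^ 2) := by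
  unfold traceAlong
  simp_rw [← hj, ← tsum_ofReal_sq_inner k, ← tsum_ofReal_sq_inner e]
  rw [ENNReal.tsum_comm]
  refine tsum_congr fun m => tsum_congr fun i => ?_
  rw [ContinuousLinearMap.adjoint_inner_left, real_inner_comm]

theorem traceAlong_eq [CompleteSpace X] {ι κ : Type*} (e : HilbertBasis ι ℝ X)
    (f : HilbertBasis κ ℝ X) {T : X →L[ℝ] X} (hT : T.IsPositive) :
    traceAlong e T = traceAlong f T := by
  obtain ⟨K, _, _, _, j₀, hj₀⟩ := exists_hilbert_of_core
    { inner := fun x y => ⟪T x, y⟫_ℝ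
      conj_inner_symm := fun x y => by
        simpa [real_inner_comm] using (hT.inner_left_eq_inner_right y x)
      re_inner_nonneg := fun x => by simpa using hT.inner_nonneg_left x
      add_left := fun x y z => by simp [inner_add_left]
      smul_left := fun x y r => by simp [inner_smul_left] }
  have hj₁ : ∀ x, ‖j₀ x‖ ^ 2 = ⟪T x, x⟫_ℝ := fun x => by
    rw [← real_inner_self_eq_norm_sq]
    exact hj₀ x x
  let j : X →L[ℝ] K := j₀.mkContinuous (Real.sqrt ‖T‖) (fun x => by
    refine abs_le_of_sq_le_sq' ?_ (by positivity) |>.2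
    rw [hj₁, mul_pow, Real.sq_sqrt (norm_nonneg _)]
    calc ⟪T x, x⟫_ℝ ≤ ‖T x‖ * ‖x‖ := real_inner_le_norm _ _
      _ ≤ ‖T‖ * ‖x‖ * ‖x‖ := by gcongr; exact T.le_opNorm x
      _ = ‖T‖ * ‖x‖ ^ 2 := by ring)
  have hj : ∀ x, ‖j x‖ ^ 2 = ⟪T x, x⟫_ℝ := hj₁
  obtain ⟨w, k, -⟩ := exists_hilbertBasis ℝ K
  rw [traceAlong_eq_of_factor e k hj, traceAlong_eq_of_factor f k hj]

theorem opTrace_eq_traceAlong [CompleteSpace X] {ι : Type*} (e : HilbertBasis ι ℝ X)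
    {T : X →L[ℝ] X} (hT : T.IsPositive) : opTrace T = traceAlong e T :=
  traceAlong_eq _ e hT

end Trace

/-! ### Strong integrals of operator-valued functions -/

section StrongIntegral

variable {X : Type*} [NormedAddCommGroup X] [InnerProductSpace ℝ X]

/-- `T = ∫_S F(r) dr` in the strong sense: for every `x` the function `r ↦ F(r) x` is (Bochner)
integrable on `S`, with integral `T x`. -/
def IsStrongIntegral (F : ℝ → X →L[ℝ] X) (S : Set ℝ) (T : X →L[ℝ] X) : Prop :=
  ∀ x, IntegrableOn (fun r => F r x) S volume ∧ T x = ∫ r in S, F r x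

open Classical in
/-- The bounded operator `∫_S F(r) dr` (strong sense); `0` if it does not exist. -/
def strongIntegral (F : ℝ → X →L[ℝ] X) (S : Set ℝ) : X →L[ℝ] X :=
  if h : ∃ T, IsStrongIntegral F S T then h.choose else 0

theorem IsStrongIntegral.strongIntegral_eq {F : ℝ → X →L[ℝ] X} {S : Set ℝ} {T : X →L[ℝ] X}
    (h : IsStrongIntegral F S T) : strongIntegral F S = T := by
  have h' : ∃ T, IsStrongIntegral F S T := ⟨T, h⟩
  rw [strongIntegral, dif_pos h']
  ext x
  rw [(h'.choose_spec x).2, (h x).2]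

end StrongIntegral

/-! ### Gaussian measures on a Hilbert space -/

section Gaussian

variable {X : Type*} [NormedAddCommGroup X] [InnerProductSpace ℝ X] [MeasurableSpace X]

/-- `μ` is the Gaussian measure `N(m, Q)`: a probability measure with characteristic function
`h ↦ exp (i⟨m, h⟩ - ⟨Q h, h⟩ / 2)`. -/
def IsGaussianLaw (μ : Measure X) (m : X) (Q : X →L[ℝ] X) : Prop :=
  IsProbabilityMeasure μ ∧
    ∀ h : X, charFun μ h =
      Complex.exp ((⟪m, h⟫_ℝ : ℂ) * Complex.I - (⟪Q h, h⟫_ℝ : ℂ) / 2)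

open Classical in
/-- The Gaussian measure `N(m, Q)`; `0` if there is none. -/
def gaussianLaw (m : X) (Q : X →L[ℝ] X) : Measure X :=
  if h : ∃ μ, IsGaussianLaw μ m Q then h.choose else 0

theorem IsGaussianLaw.gaussianLaw_eq [CompleteSpace X] [SecondCountableTopology X] [BorelSpace X]
    {μ : Measure X} {m : X} {Q : X →L[ℝ] X} (h : IsGaussianLaw μ m Q) : gaussianLaw m Q = μ := by
  have h' : ∃ μ, IsGaussianLaw μ m Q := ⟨μ, h⟩
  rw [gaussianLaw, dif_pos h']
  have := h.1
  have := h'.choose_spec.1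
  refine Measure.ext_of_charFun ?_
  ext x
  rw [h'.choose_spec.2, h.2]

end Gaussian

/-! ### Ornstein-Uhlenbeck evolution operators -/

section OrnsteinUhlenbeck

variable {X : Type*} [NormedAddCommGroup X] [InnerProductSpace ℝ X]

/-- The operator `U(t,r) B(r) B(r)* U(t,r)*`. -/
def covIntegrand [CompleteSpace X] (U : ℝ → ℝ → X →L[ℝ] X) (B : ℝ → X →L[ℝ] X) (t r : ℝ) :
    X →L[ℝ] X :=
  U t r ∘L (B r ∘L ContinuousLinearMap.adjoint (B r)) ∘L ContinuousLinearMap.adjoint (U t r)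

/-- `Q(t,s) = ∫_s^t U(t,r) B(r) B(r)* U(t,r)* dr`. -/
def covOp [CompleteSpace X] (U : ℝ → ℝ → X →L[ℝ] X) (B : ℝ → X →L[ℝ] X) (t s : ℝ) : X →L[ℝ] X :=
  strongIntegral (covIntegrand U B t) (Ioc s t)

/-- `Q(t,-∞) = ∫_{-∞}^t U(t,r) B(r) B(r)* U(t,r)* dr`. -/
def covOpInf [CompleteSpace X] (U : ℝ → ℝ → X →L[ℝ] X) (B : ℝ → X →L[ℝ] X) (t : ℝ) : X →L[ℝ] X :=
  strongIntegral (covIntegrand U B t) (Iic t)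

/-- `U(t,s)`, `s ≤ t`, is a strongly continuous, exponentially bounded evolution operator. The
values `U t s` with `t < s` are irrelevant. -/
structure IsEvolutionOperator (U : ℝ → ℝ → X →L[ℝ] X) : Prop where
  strong_cont : ∀ x, ContinuousOn (fun p : ℝ × ℝ => U p.2 p.1 x) {p | p.1 ≤ p.2}
  self : ∀ t, U t t = ContinuousLinearMap.id ℝ X
  comp : ∀ s r t, s ≤ r → r ≤ t → U t r ∘L U r s = U t s
  exp_bound : ∃ M > (0 : ℝ), ∃ ζ : ℝ, ∀ s t, s ≤ t → ‖U t s‖ ≤ M * Real.exp (-ζ * (t - s))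

/-- The standing assumptions on `U` and `B`. -/
structure OUHypothesis [CompleteSpace X] (U : ℝ → ℝ → X →L[ℝ] X) (B : ℝ → X →L[ℝ] X) : Prop where
  evolution : IsEvolutionOperator U
  bounded : ∃ K > (0 : ℝ), ∀ t, ‖B t‖ ≤ K
  strong_cont : ∀ x, Continuous fun t => B t x
  finite_trace : ∀ s t, s < t → opTrace (covOp U B t s) < ∞

/-- The Ornstein-Uhlenbeck evolution operator: `P_{r,r} = I` and
`P_{s,t} φ(x) = ∫ φ(y) N(U(t,s)x, Q(t,s))(dy)` for `s < t`. -/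
def ouEvolution [CompleteSpace X] [MeasurableSpace X] (U : ℝ → ℝ → X →L[ℝ] X)
    (B : ℝ → X →L[ℝ] X) (s t : ℝ) (φ : X → ℝ) (x : X) : ℝ :=
  if s = t then φ x else ∫ y, φ y ∂(gaussianLaw (U t s x) (covOp U B t s))

/-- The transition operator of the deterministic flow, `V_{s,t} φ(x) = φ(U(t,s)x)`. -/
def flowEvolution (U : ℝ → ℝ → X →L[ℝ] X) (s t : ℝ) (φ : X → ℝ) (x : X) : ℝ :=
  φ (U t s x)

/-- `ν` is an evolution system of measures on `ℝ` for the family `P s t`, `s ≤ t`: the `ν t` are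
Borel probability measures and `∫ P_{s,t} φ dν_s = ∫ φ dν_t` for `s ≤ t` and `φ ∈ C_b(X)`. -/
def IsEvolutionSystem [MeasurableSpace X] (P : ℝ → ℝ → (X → ℝ) → X → ℝ) (ν : ℝ → Measure X) :
    Prop :=
  (∀ t, IsProbabilityMeasure (ν t)) ∧
    ∀ s t, s ≤ t → ∀ φ : X →ᵇ ℝ, ∫ x, P s t φ x ∂(ν s) = ∫ x, φ x ∂(ν t)

/-- The measures `γ_t = N(0, Q(t,-∞))`. -/
def ouGaussian [CompleteSpace X] [MeasurableSpace X] (U : ℝ → ℝ → X →L[ℝ] X)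
    (B : ℝ → X →L[ℝ] X) (t : ℝ) : Measure X :=
  gaussianLaw 0 (covOpInf U B t)

end OrnsteinUhlenbeck

end

/-! Write γ_t = N(0, Q(t,-∞)). Two facts about G G* with G = U(t,r) B(r) give part 1: its operator
norm is at most its trace, and by Tonelli the trace of ∫ G G* is the integral of the traces. The
uniform bound on Tr Q(t,s) thus makes the trace integrable up to -∞ and supplies a majorant for the
strong integral. No decay of U is needed.

Since P_{s,t} integrates against a translate of N(0, Q(t,s)), ν is an evolution system iff ν_t =
N(0, Q(t,s)) ⋆ U(t,s)ν_s for s < t. In characteristic functions: ν̂_t(x) = exp(-⟨Q(t,s)x, x⟩/2)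
ν̂_s(U(t,s)* x). For γ this is the cocycle identity `covOpInf_eq_add`; multiplying by the flow
relation μ̂_t(x) = μ̂_s(U(t,s)* x) gives the "if" half of part 3.

Conversely, γ̂_t never vanishes, and the quotient ν̂_t/γ̂_t satisfies the flow relation
automatically. It must be shown to be a characteristic function. It is the limit of those of
U(t,s)ν_s as s → -∞, so tightness of these measures suffices. The convolutions N(0, Q(t,s)) ⋆
U(t,s)γ_s all equal γ_t and their left factors are symmetric, so the Gaussians N(0, Q(t,s)) are
tight; the convolutions N(0, Q(t,s)) ⋆ U(t,s)ν_s all equal ν_t, so their right factors are tight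
too. -/

/-! ### Tightness of convolution factors -/

section Tight

open Filter Topology
open scoped Pointwise

variable {X : Type*} [NormedAddCommGroup X] [MeasurableSpace X] [BorelSpace X]
  [SecondCountableTopology X]

/-- If the convolutions of two families of probability measures form a tight family and the left
factors are tight, then so are the right factors. -/
theorem isTightMeasureSet_range_right_of_conv {ι : Type*} {κ ρ : ι → Measure X}
    [∀ i, IsProbabilityMeasure (κ i)] [∀ i, IsProbabilityMeasure (ρ i)]
    (hκ : IsTightMeasureSet (range κ))
    (hconv : IsTightMeasureSet (range fun i => (κ i).conv (ρ i))) :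
    IsTightMeasureSet (range ρ) := by
  rw [isTightMeasureSet_iff_exists_isCompact_measure_compl_le] at *
  intro ε hε
  obtain ⟨K, hK, hKε⟩ := hconv (ε / 2) (ENNReal.half_pos hε.ne')
  obtain ⟨L, hL, hLε⟩ := hκ (ε / 2) (ENNReal.half_pos hε.ne')
  -- If x ∈ L and x + y ∈ K, then y ∈ K - L.
  refine ⟨K - L, sub_eq_add_neg K L ▸ hK.add hL.neg, ?_⟩
  rintro _ ⟨i, rfl⟩
  have hKm : MeasurableSet Kᶜ := hK.isClosed.measurableSet.compl
  calc ρ i (K - L)ᶜ = ((κ i).prod (ρ i)) (univ ×ˢ (K - L)ᶜ) := by simp [Measure.prod_prod]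
    _ ≤ ((κ i).prod (ρ i)) ((Lᶜ ×ˢ univ) ∪ (fun p : X × X => p.1 + p.2) ⁻¹' Kᶜ) := by
        refine measure_mono ?_
        rintro ⟨x, y⟩ ⟨-, hy⟩
        by_contra hcon
        simp only [mem_union, mem_prod, mem_compl_iff, mem_univ, and_true, mem_preimage,
          not_or, not_not] at hcon
        exact hy ⟨x + y, hcon.2, x, hcon.1, by simp⟩
    _ ≤ ((κ i).prod (ρ i)) (Lᶜ ×ˢ univ) +
          ((κ i).prod (ρ i)) ((fun p : X × X => p.1 + p.2) ⁻¹' Kᶜ) := measure_union_le _ _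
    _ = κ i Lᶜ + (κ i).conv (ρ i) Kᶜ := by
        rw [Measure.prod_prod, measure_univ, mul_one, Measure.conv,
          Measure.map_apply (by fun_prop) hKm]
    _ ≤ ε / 2 + ε / 2 := add_le_add (hLε _ ⟨i, rfl⟩) (hKε _ ⟨i, rfl⟩)
    _ = ε := ENNReal.add_halves ε

/-- If the convolutions of two families of probability measures form a tight family and the left
factors are symmetric, then the left factors are tight. -/
theorem isTightMeasureSet_range_left_of_conv_of_symm [NormedSpace ℝ X] {ι : Type*}
    {κ ρ : ι → Measure X}
    [∀ i, IsProbabilityMeasure (κ i)] [∀ i, IsProbabilityMeasure (ρ i)]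
    (hκ : ∀ i, (κ i).map (fun x => -x) = κ i)
    (hconv : IsTightMeasureSet (range fun i => (κ i).conv (ρ i))) :
    IsTightMeasureSet (range κ) := by
  rw [isTightMeasureSet_iff_exists_isCompact_measure_compl_le] at *
  intro ε hε
  obtain ⟨K, hK, hKε⟩ := hconv (ε / 2) (ENNReal.half_pos hε.ne')
  -- From 2x = (x + y) - (-x + y): if both x + y and -x + y lie in K, then x lies in this set.
  refine ⟨(2⁻¹ : ℝ) • (K - K), IsCompact.smul _ (sub_eq_add_neg K K ▸ hK.add hK.neg), ?_⟩
  rintro _ ⟨i, rfl⟩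
  have hKm : MeasurableSet Kᶜ := hK.isClosed.measurableSet.compl
  -- By symmetry of the left factor, -x + y has the same law as x + y.
  have h₂ : ((κ i).prod (ρ i)) ((fun p : X × X => -p.1 + p.2) ⁻¹' Kᶜ) =
      (κ i).conv (ρ i) Kᶜ := by
    conv_rhs => rw [Measure.conv, ← hκ i]
    rw [← Measure.map_id (μ := ρ i), Measure.map_prod_map _ _ (by fun_prop) (by fun_prop),
      Measure.map_map (by fun_prop) (by fun_prop), Measure.map_apply (by fun_prop) hKm,
      Measure.map_id]
    rfl
  calc κ i ((2⁻¹ : ℝ) • (K - K))ᶜ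
      = ((κ i).prod (ρ i)) (((2⁻¹ : ℝ) • (K - K))ᶜ ×ˢ univ) := by simp [Measure.prod_prod]
    _ ≤ ((κ i).prod (ρ i)) (((fun p : X × X => p.1 + p.2) ⁻¹' Kᶜ) ∪
          (fun p : X × X => -p.1 + p.2) ⁻¹' Kᶜ) := by
        refine measure_mono ?_
        rintro ⟨x, y⟩ ⟨hx, -⟩
        by_contra hcon
        simp only [mem_union, mem_compl_iff, mem_preimage, not_or, not_not] at hcon
        refine hx ⟨(2 : ℝ) • x, ⟨x + y, hcon.1, -x + y, hcon.2, ?_⟩, ?_⟩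
        · simp only [two_smul]; abel
        · simp [smul_smul]
    _ ≤ _ := measure_union_le _ _
    _ = (κ i).conv (ρ i) Kᶜ + (κ i).conv (ρ i) Kᶜ := by
        rw [h₂, Measure.conv, Measure.map_apply (by fun_prop) hKm]
    _ ≤ ε / 2 + ε / 2 := add_le_add (hKε _ ⟨i, rfl⟩) (hKε _ ⟨i, rfl⟩)
    _ = ε := ENNReal.add_halves ε

end Tight

/-! ### Limits of characteristic functions under tightness -/

section CharFunLimit

open Filter Topology

variable {X : Type*} [NormedAddCommGroup X] [InnerProductSpace ℝ X] [MeasurableSpace X]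
  [BorelSpace X]

/-- The pointwise limit of the characteristic functions of a tight sequence of probability measures
is the characteristic function of a probability measure. -/
theorem exists_charFun_eq_of_isTightMeasureSet {ρ : ℕ → Measure X}
    [∀ n, IsProbabilityMeasure (ρ n)] (hρ : IsTightMeasureSet (range ρ)) {f : X → ℂ}
    (hf : ∀ h, Tendsto (fun n => charFun (ρ n) h) atTop (𝓝 (f h))) :
    ∃ μ : Measure X, IsProbabilityMeasure μ ∧ ∀ h, charFun μ h = f h := by
  let σ : ℕ → ProbabilityMeasure X := fun n => ⟨ρ n, inferInstance⟩
  have hS : IsTightMeasureSet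
      {((μ : ProbabilityMeasure X) : Measure X) | μ ∈ range σ} := by
    refine hρ.subset ?_
    rintro _ ⟨μ, hμ, rfl⟩
    obtain ⟨n, rfl⟩ := hμ
    exact ⟨n, rfl⟩
  obtain ⟨μ, -, hμ⟩ := (isCompact_closure_of_isTightMeasureSet hS).exists_mapClusterPt
    (f := atTop) (u := σ) (by
      rw [le_principal_iff]
      exact mem_map.2 (Filter.Eventually.of_forall fun n => subset_closure ⟨n, rfl⟩))
  -- An ultrafilter finer than `atTop` replaces the choice of a weakly convergent subsequence.
  obtain ⟨F, hF, hFμ⟩ := mapClusterPt_iff_ultrafilter.1 hμ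
  refine ⟨μ, inferInstance, fun h => ?_⟩
  refine tendsto_nhds_unique ?_ ((hf h).mono_left hF)
  have := (ProbabilityMeasure.tendsto_iff_forall_integral_rclike_tendsto ℂ).1 hFμ
    (BoundedContinuousFunction.innerProbChar h)
  simp only [charFun_eq_integral_innerProbChar]
  exact this

end CharFunLimit

/-! ### Existence of Gaussian measures -/

section GaussianExistence

open Filter Topology ProbabilityTheory

/-- A non-negative operator is of the form `j* j`. -/
theorem ContinuousLinearMap.IsPositive.exists_norm_sq_eq {X : Type u} [NormedAddCommGroup X]
    [InnerProductSpace ℝ X] {T : X →L[ℝ] X} (hT : T.IsPositive) :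
    ∃ (K : Type u) (_ : NormedAddCommGroup K) (_ : InnerProductSpace ℝ K) (_ : CompleteSpace K)
      (j : X →L[ℝ] K), ∀ x, ‖j x‖ ^ 2 = ⟪T x, x⟫_ℝ := by
  obtain ⟨K, _, _, _, j₀, hj₀⟩ := exists_hilbert_of_core
    { inner := fun x y => ⟪T x, y⟫_ℝ
      conj_inner_symm := fun x y => by
        simpa [real_inner_comm] using (hT.inner_left_eq_inner_right y x)
      re_inner_nonneg := fun x => by simpa using hT.inner_nonneg_left x
      add_left := fun x y z => by simp [inner_add_left]
      smul_left := fun x y r => by simp [inner_smul_left] }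
  have hj₁ : ∀ x, ‖j₀ x‖ ^ 2 = ⟪T x, x⟫_ℝ := fun x => by
    rw [← real_inner_self_eq_norm_sq]
    exact hj₀ x x
  refine ⟨K, inferInstance, inferInstance, inferInstance,
    j₀.mkContinuous (Real.sqrt ‖T‖) fun x => ?_, hj₁⟩
  refine abs_le_of_sq_le_sq' ?_ (by positivity) |>.2
  rw [hj₁, mul_pow, Real.sq_sqrt (norm_nonneg _)]
  calc ⟪T x, x⟫_ℝ ≤ ‖T x‖ * ‖x‖ := real_inner_le_norm _ _
    _ ≤ ‖T‖ * ‖x‖ * ‖x‖ := by gcongr; exact T.le_opNorm x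
    _ = ‖T‖ * ‖x‖ ^ 2 := by ring

variable {Ω X : Type*} [MeasurableSpace Ω] {P : Measure Ω}
  [NormedAddCommGroup X] [InnerProductSpace ℝ X]

/-- Multiplication by a normalized square integrable random variable is an isometry of `X` into
`L²(Ω; X)`. -/
theorem exists_linearIsometry_smul {ξ : Ω → ℝ} (hξ : MemLp ξ 2 P) (h1 : ∫ ω, ξ ω ^ 2 ∂P = 1) :
    ∃ V : X →ₗᵢ[ℝ] Lp X 2 P, ∀ x, V x =ᵐ[P] fun ω => ξ ω • x := by
  have hmem : ∀ x : X, MemLp (fun ω => ξ ω • x) 2 P := fun x =>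
    hξ.of_le_mul (c := ‖x‖) (hξ.1.smul aestronglyMeasurable_const)
      (ae_of_all _ fun ω => by rw [norm_smul, mul_comm])
  let V : X →ₗ[ℝ] Lp X 2 P :=
    { toFun := fun x => (hmem x).toLp
      map_add' := fun x y => by
        rw [← MemLp.toLp_add]
        congr 1
        ext ω
        simp
      map_smul' := fun c x => by
        rw [RingHom.id_apply, ← MemLp.toLp_const_smul]
        congr 1
        ext ω
        simp [smul_comm c] }
  have hV : ∀ x, V x =ᵐ[P] fun ω => ξ ω • x := fun x => (hmem x).coeFn_toLp
  refine ⟨⟨V, fun x => ?_⟩, hV⟩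
  have : ‖V x‖ ^ 2 = ‖x‖ ^ 2 := by
    rw [← real_inner_self_eq_norm_sq, L2.inner_def, ← one_mul (‖x‖ ^ 2), ← h1,
      ← integral_mul_const]
    refine integral_congr_ae ?_
    filter_upwards [hV x] with ω hω
    rw [hω, real_inner_self_eq_norm_sq, norm_smul, mul_pow, Real.norm_eq_abs, sq_abs]
  exact (sq_eq_sq₀ (norm_nonneg _) (norm_nonneg _)).1 this

variable [IsProbabilityMeasure P] [MeasurableSpace X] [BorelSpace X]

/-- The characteristic function of the law of a square integrable random variable is a Lipschitz
function of the variable. -/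
theorem norm_charFun_map_sub_le (f g : Lp X 2 P) (h : X) :
    ‖charFun (P.map f) h - charFun (P.map g) h‖ ≤ ‖h‖ * ‖f - g‖ := by
  have hm : ∀ f : Lp X 2 P, AEMeasurable f P := fun f =>
    (Lp.aestronglyMeasurable f).aemeasurable
  have hsm : ∀ f : Lp X 2 P, AEStronglyMeasurable
      (fun ω => Complex.exp (⟪f ω, h⟫_ℝ * Complex.I)) P := fun f =>
    (by fun_prop : Continuous fun x : X =>
      Complex.exp (⟪x, h⟫_ℝ * Complex.I)).comp_aestronglyMeasurable (Lp.aestronglyMeasurable f)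
  have hchar : ∀ f : Lp X 2 P,
      charFun (P.map f) h = ∫ ω, Complex.exp (⟪f ω, h⟫_ℝ * Complex.I) ∂P := fun f => by
    rw [charFun_apply, integral_map (hm f)]
    exact (by fun_prop : Continuous fun x : X =>
      Complex.exp (⟪x, h⟫_ℝ * Complex.I)).measurable.aestronglyMeasurable
  have hint : ∀ f : Lp X 2 P, Integrable
      (fun ω => Complex.exp (⟪f ω, h⟫_ℝ * Complex.I)) P := fun f =>
    Integrable.of_bound (hsm f) 1 (ae_of_all _ fun ω => by simp [Complex.norm_exp_ofReal_mul_I])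
  have hle : eLpNorm (f - g : Lp X 2 P) 1 P ≤ eLpNorm (f - g : Lp X 2 P) 2 P :=
    eLpNorm_le_eLpNorm_of_exponent_le (by norm_num) (Lp.aestronglyMeasurable _)
  have h1 : Integrable (fun ω => ‖(f - g : Lp X 2 P) ω‖) P :=
    ((Lp.memLp (f - g)).integrable (by norm_num)).norm
  have h2 : ∫ ω, ‖(f - g : Lp X 2 P) ω‖ ∂P ≤ ‖f - g‖ := by
    rw [integral_norm_eq_lintegral_enorm (Lp.aestronglyMeasurable _),
      ← eLpNorm_one_eq_lintegral_enorm, Lp.norm_def]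
    exact ENNReal.toReal_mono (Lp.eLpNorm_ne_top _) hle
  rw [hchar, hchar, ← integral_sub (hint f) (hint g)]
  calc _ ≤ ∫ ω, ‖h‖ * ‖(f - g : Lp X 2 P) ω‖ ∂P := by
        refine norm_integral_le_of_norm_le (h1.const_mul _) ?_
        filter_upwards [Lp.coeFn_sub f g] with ω hω
        rw [hω, Pi.sub_apply]
        -- Factoring out a unimodular exponential leaves |e^{ia} - 1| ≤ |a|.
        have key : Complex.exp (⟪f ω, h⟫_ℝ * Complex.I) - Complex.exp (⟪g ω, h⟫_ℝ * Complex.I) =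
            Complex.exp (⟪g ω, h⟫_ℝ * Complex.I) *
              (Complex.exp (Complex.I * (⟪f ω - g ω, h⟫_ℝ : ℝ)) - 1) := by
          rw [mul_sub, ← Complex.exp_add, mul_one, inner_sub_left]
          push_cast
          ring_nf
        rw [key, norm_mul, Complex.norm_exp_ofReal_mul_I, one_mul]
        calc _ ≤ ‖⟪f ω - g ω, h⟫_ℝ‖ := Real.norm_exp_I_mul_ofReal_sub_one_le
          _ ≤ ‖f ω - g ω‖ * ‖h‖ := norm_inner_le_norm _ _
          _ = _ := mul_comm _ _
    _ = ‖h‖ * ∫ ω, ‖(f - g : Lp X 2 P) ω‖ ∂P := integral_const_mul _ _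
    _ ≤ ‖h‖ * ‖f - g‖ := by gcongr

/-- The law of `∑ ξᵢ vᵢ` with independent standard normal variables `ξᵢ`. -/
theorem exists_charFun_eq_of_summable [SecondCountableTopology X] [CompleteSpace X]
    {ι : Type*} (v : ι → X) (hv : Summable fun i => ‖v i‖ ^ 2)
    {q : X → ℝ} (hq : ∀ h, HasSum (fun i => ⟪v i, h⟫_ℝ ^ 2) (q h)) :
    ∃ μ : Measure X, IsProbabilityMeasure μ ∧
      ∀ h, charFun μ h = Complex.exp (-(q h : ℂ) / 2) := by
  classical
  let P : Measure (ι → ℝ) := Measure.infinitePi fun _ => gaussianReal 0 1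
  have hm : ∀ i, AEMeasurable (fun ω : ι → ℝ => ω i) P := fun i =>
    (measurable_pi_apply i).aemeasurable
  have hm' : ∀ i, AEMeasurable (fun ω : ι → ℝ => ω i • v i) P := fun i => (hm i).smul_const _
  have hlaw : ∀ i, P.map (fun ω => ω i) = gaussianReal 0 1 := fun i =>
    Measure.infinitePi_map_eval _ i
  have hind : iIndepFun (fun (i : ι) (ω : ι → ℝ) => ω i) P :=
    iIndepFun_infinitePi (X := fun _ x => x) fun _ => measurable_id
  have hξ : ∀ i, MemLp (fun ω : ι → ℝ => ω i) 2 P := fun i => by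
    have := memLp_id_gaussianReal' (μ := 0) (v := 1) 2 (by norm_num)
    rw [← hlaw i] at this
    exact this.comp_of_map (hm i)
  have hmean : ∀ i, ∫ ω : ι → ℝ, ω i ∂P = 0 := fun i => by
    rw [← integral_map (φ := fun ω : ι → ℝ => ω i) (f := fun x => x) (hm i)
      (by fun_prop), hlaw]
    exact integral_id_gaussianReal
  have hvar : ∀ i, ∫ ω : ι → ℝ, ω i ^ 2 ∂P = 1 := fun i => by
    have := variance_fun_id_gaussianReal (μ := 0) (v := 1)
    rw [variance_of_integral_eq_zero (by fun_prop) (by exact integral_id_gaussianReal)] at this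
    rw [← integral_map (φ := fun ω : ι → ℝ => ω i) (f := fun x => x ^ 2) (hm i)
      (by fun_prop), hlaw]
    simpa using this
  choose V hV using fun i => exists_linearIsometry_smul (X := X) (hξ i) (hvar i)
  -- Independence and zero mean make the ranges of the isometries x ↦ ξᵢ x orthogonal in L².
  have horth : OrthogonalFamily ℝ (fun _ : ι => X) V := fun i j hij x y => by
    have h0 : ∫ ω : ι → ℝ, ω i * ω j ∂P = 0 := by
      rw [(hind.indepFun hij).integral_fun_mul_eq_mul_integral (hξ i).1 (hξ j).1, hmean, zero_mul]
    rw [L2.inner_def, ← zero_mul ⟪x, y⟫_ℝ, ← h0, ← integral_mul_const]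
    refine integral_congr_ae ?_
    filter_upwards [hV i x, hV j y] with ω h1 h2
    rw [h1, h2, real_inner_smul_left, real_inner_smul_right, mul_assoc]
  -- Orthogonality turns summability of ‖vᵢ‖² into L² convergence of ∑ ξᵢ vᵢ. This also covers an
  -- uncountable index set.
  obtain ⟨Z, hZ⟩ := (horth.summable_iff_norm_sq_summable v).2 hv
  have hZm : AEMeasurable Z P := (Lp.aestronglyMeasurable Z).aemeasurable
  refine ⟨P.map Z, Measure.isProbabilityMeasure_map hZm, fun h => ?_⟩
  have hlim : Tendsto (fun s : Finset ι => charFun (P.map (∑ i ∈ s, V i (v i) : Lp X 2 P)) h)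
      atTop (𝓝 (charFun (P.map Z) h)) := by
    rw [tendsto_iff_norm_sub_tendsto_zero]
    refine squeeze_zero (fun _ => norm_nonneg _) (fun s => norm_charFun_map_sub_le _ _ h) ?_
    simpa using (tendsto_iff_norm_sub_tendsto_zero.1 hZ).const_mul ‖h‖
  refine tendsto_nhds_unique hlim ?_
  have hfin : ∀ s : Finset ι, charFun (P.map (∑ i ∈ s, V i (v i) : Lp X 2 P)) h =
      Complex.exp (-((∑ i ∈ s, ⟪v i, h⟫_ℝ ^ 2 : ℝ) : ℂ) / 2) := fun s => by
    have hae : (∑ i ∈ s, V i (v i) : Lp X 2 P) =ᵐ[P] fun ω => ∑ i ∈ s, ω i • v i := by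
      refine (Lp.coeFn_finsetSum _ _).trans ?_
      have : ∀ᵐ ω ∂P, ∀ i ∈ s, V i (v i) ω = ω i • v i :=
        (eventually_all_finset s).2 fun i _ => hV i (v i)
      filter_upwards [this] with ω hω
      rw [Finset.sum_apply]
      exact Finset.sum_congr rfl hω
    have hind' : iIndepFun (fun (i : ι) (ω : ι → ℝ) => ω i • v i) P :=
      hind.comp (fun i x => x • v i) fun i => by fun_prop
    rw [Measure.map_congr hae,
      (hind'.precomp (g := ((↑) : s → ι)) Subtype.val_injective
        |>.charFun_map_fun_finsetSum_eq_prod (fun i _ => hm' i)), Finset.prod_apply]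
    push_cast
    rw [← Finset.sum_neg_distrib, Finset.sum_div, Complex.exp_sum]
    refine Finset.prod_congr rfl fun i _ => ?_
    have := charFun_gaussianReal (μ := 0) (v := 1) ⟪v i, h⟫_ℝ
    rw [← hlaw i, charFun_apply, integral_map (hm i) (by fun_prop)] at this
    rw [charFun_apply, integral_map (hm' i) (by fun_prop)]
    simp only [real_inner_smul_left]
    simp at this
    convert this using 3
    · simp [mul_comm]
    · ring
  simp_rw [hfin]
  have : Continuous fun x : ℝ => Complex.exp (-(x : ℂ) / 2) := by fun_prop
  exact (this.tendsto _).comp (hq h)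

/-- A non-negative operator of finite trace is the covariance of a centred Gaussian measure. -/
theorem exists_isGaussianLaw_zero [SecondCountableTopology X] [CompleteSpace X] {T : X →L[ℝ] X}
    (hT : T.IsPositive) (htr : opTrace T < ∞) : ∃ μ : Measure X, IsGaussianLaw μ 0 T := by
  obtain ⟨K, _, _, _, j, hj⟩ := hT.exists_norm_sq_eq
  obtain ⟨w, k, -⟩ := exists_hilbertBasis ℝ K
  obtain ⟨w', e, -⟩ := exists_hilbertBasis ℝ X
  rw [opTrace_eq_traceAlong e hT, traceAlong_eq_of_factor e k hj] at htr
  have hsum : Summable fun m => ‖ContinuousLinearMap.adjoint j (k m)‖ ^ 2 :=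
    (ENNReal.summable_toReal htr.ne).congr fun m => ENNReal.toReal_ofReal (by positivity)
  -- With v_m = j* k_m, Parseval in K gives ∑ ⟨v_m, h⟩² = ‖j h‖² = ⟨T h, h⟩.
  obtain ⟨μ, hμ, hchar⟩ := exists_charFun_eq_of_summable _ hsum (q := fun h => ⟪T h, h⟫_ℝ)
    fun h => by
      have := k.hasSum_inner_mul_inner (j h) (j h)
      rw [real_inner_self_eq_norm_sq, hj] at this
      refine this.congr_fun fun m => ?_
      rw [ContinuousLinearMap.adjoint_inner_left, real_inner_comm (j h), sq]
  exact ⟨μ, hμ, fun h => by simp [hchar, neg_div]⟩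

theorem IsGaussianLaw.map_const_add {μ : Measure X} {T : X →L[ℝ] X}
    (h : IsGaussianLaw μ 0 T) (m : X) : IsGaussianLaw (μ.map (m + ·)) m T := by
  have := h.1
  refine ⟨Measure.isProbabilityMeasure_map (by fun_prop), fun x => ?_⟩
  rw [charFun_map_const_add, h.2, ← Complex.exp_add]
  congr 1
  simp
  ring

end GaussianExistence

/-! ### Measurability of strongly measurable operator families -/

section WeakMeasurability

open Filter Topology

variable {X : Type*} [NormedAddCommGroup X] [InnerProductSpace ℝ X]

/-- A Hilbert basis of a separable space is countable. -/
theorem HilbertBasis.countable [TopologicalSpace.SeparableSpace X] {ι : Type*}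
    (e : HilbertBasis ι ℝ X) : Countable ι := by
  -- Distinct basis vectors are at distance √2 > 1, so balls of radius 1/2 around them are disjoint.
  refine Pairwise.countable_of_isOpen_disjoint (s := fun i => Metric.ball (e i) (1 / 2))
    (fun i j hij => ?_) (fun i => Metric.isOpen_ball) (fun i => ⟨e i, by simp⟩)
  refine Metric.ball_disjoint_ball ?_
  have h : ‖e i - e j‖ ^ 2 = 2 := by
    rw [norm_sub_sq_real, e.orthonormal.1, e.orthonormal.1, e.orthonormal.2 hij]
    norm_num
  rw [dist_eq_norm]
  nlinarith [norm_nonneg (e i - e j)]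

variable [CompleteSpace X] [TopologicalSpace.SeparableSpace X]
  {α : Type*} [MeasurableSpace α] {μ : Measure α}

/-- In a separable Hilbert space, weak measurability implies strong measurability. -/
theorem aestronglyMeasurable_of_inner {f : α → X}
    (hf : ∀ y, AEStronglyMeasurable (fun a => ⟪y, f a⟫_ℝ) μ) : AEStronglyMeasurable f μ := by
  obtain ⟨w, e, -⟩ := exists_hilbertBasis ℝ X
  have := e.countable
  refine aestronglyMeasurable_of_tendsto_ae (atTop : Filter (Finset w))
    (f := fun s a => ∑ i ∈ s, ⟪e i, f a⟫_ℝ • e i) (fun s => ?_) (ae_of_all _ fun a => ?_)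
  · exact Finset.aestronglyMeasurable_fun_sum _ fun i _ => (hf (e i)).smul_const _
  · have := e.hasSum_repr (f a)
    simp only [e.repr_apply_apply] at this
    exact this

theorem aestronglyMeasurable_adjoint_apply {A : α → X →L[ℝ] X}
    (hA : ∀ x, AEStronglyMeasurable (fun a => A a x) μ) (x : X) :
    AEStronglyMeasurable (fun a => ContinuousLinearMap.adjoint (A a) x) μ :=
  aestronglyMeasurable_of_inner fun y => by
    simp only [ContinuousLinearMap.adjoint_inner_right]
    exact (hA y).inner aestronglyMeasurable_const

/-- Tested against y, the operator moves to the other side as ⟨A* y, f⟩, a pairing of two measurable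
functions. Measurability of A in operator norm is not needed. -/
theorem aestronglyMeasurable_apply_apply {A : α → X →L[ℝ] X}
    (hA : ∀ x, AEStronglyMeasurable (fun a => A a x) μ) {f : α → X}
    (hf : AEStronglyMeasurable f μ) : AEStronglyMeasurable (fun a => A a (f a)) μ :=
  aestronglyMeasurable_of_inner fun y => by
    simp only [← ContinuousLinearMap.adjoint_inner_left]
    exact (aestronglyMeasurable_adjoint_apply hA y).inner hf

theorem aestronglyMeasurable_self_comp_adjoint {G : α → X →L[ℝ] X}
    (hG : ∀ x, AEStronglyMeasurable (fun a => G a x) μ) (x : X) :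
    AEStronglyMeasurable (fun a => (G a ∘L ContinuousLinearMap.adjoint (G a)) x) μ :=
  aestronglyMeasurable_apply_apply hG (aestronglyMeasurable_adjoint_apply hG x)

end WeakMeasurability

/-! ### Strong integrals: existence, positivity and trace -/

section StrongIntegral

variable {X : Type*} [NormedAddCommGroup X] [InnerProductSpace ℝ X]
  {F F' : ℝ → X →L[ℝ] X} {S S' : Set ℝ} {T T' : X →L[ℝ] X}

/-- The majorant of the operator norms gives integrability of every orbit, and its integral bounds
the norm of the resulting operator. -/
theorem exists_isStrongIntegral_of_norm_le
    (hm : ∀ x, AEStronglyMeasurable (fun r => F r x) (volume.restrict S)) {g : ℝ → ℝ}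
    (hg : IntegrableOn g S) (hb : ∀ᵐ r ∂volume.restrict S, ‖F r‖ ≤ g r) :
    ∃ T, IsStrongIntegral F S T := by
  have hb' : ∀ x, ∀ᵐ r ∂volume.restrict S, ‖F r x‖ ≤ g r * ‖x‖ := fun x => by
    filter_upwards [hb] with r hr
    exact (F r).le_of_opNorm_le hr x
  have hint : ∀ x, IntegrableOn (fun r => F r x) S := fun x =>
    (hg.mul_const ‖x‖).mono' (hm x) (hb' x)
  let L : X →ₗ[ℝ] X :=
    { toFun := fun x => ∫ r in S, F r x
      map_add' := fun x y => by
        simp only [map_add]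
        exact integral_add (hint x) (hint y)
      map_smul' := fun c x => by
        simp only [map_smul, RingHom.id_apply]
        exact integral_smul c _ }
  refine ⟨L.mkContinuous (∫ r in S, g r) fun x => ?_, fun x => ⟨hint x, rfl⟩⟩
  calc ‖L x‖ ≤ ∫ r in S, g r * ‖x‖ := norm_integral_le_of_norm_le (hg.mul_const _) (hb' x)
    _ = _ := integral_mul_const _ _

namespace IsStrongIntegral

theorem unique (h : IsStrongIntegral F S T) (h' : IsStrongIntegral F S T') : T = T' :=
  h.strongIntegral_eq.symm.trans h'.strongIntegral_eq

theorem congr (h : IsStrongIntegral F S T) (hS : MeasurableSet S) (hF : ∀ r ∈ S, F r = F' r) :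
    IsStrongIntegral F' S T := fun x => by
  have : ∀ r ∈ S, F r x = F' r x := fun r hr => by rw [hF r hr]
  exact ⟨(h x).1.congr_fun this hS, (h x).2.trans (setIntegral_congr_fun hS this)⟩

theorem union (h : IsStrongIntegral F S T) (h' : IsStrongIntegral F S' T')
    (hd : Disjoint S S') (hS' : MeasurableSet S') : IsStrongIntegral F (S ∪ S') (T + T') :=
  fun x => ⟨(h x).1.union (h' x).1, by
    rw [setIntegral_union hd hS' (h x).1 (h' x).1, ← (h x).2, ← (h' x).2,
      add_apply]⟩

theorem inner_eq [CompleteSpace X] (h : IsStrongIntegral F S T) (x y : X) :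
    ⟪T x, y⟫_ℝ = ∫ r in S, ⟪F r x, y⟫_ℝ := by
  simp only [real_inner_comm y]
  rw [(h x).2, integral_inner (h x).1]

theorem comp [CompleteSpace X] (h : IsStrongIntegral F S T) (A C : X →L[ℝ] X) :
    IsStrongIntegral (fun r => A ∘L F r ∘L C) S (A ∘L T ∘L C) := fun x =>
  ⟨A.integrable_comp (h (C x)).1, by
    simp only [ContinuousLinearMap.comp_apply]
    rw [(h (C x)).2, A.integral_comp_comm (h (C x)).1]⟩

theorem isPositive [CompleteSpace X] (h : IsStrongIntegral F S T) (hF : ∀ r, (F r).IsPositive) :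
    T.IsPositive := by
  refine ⟨fun x y => ?_, fun x => ?_⟩
  · simp only [ContinuousLinearMap.coe_coe]
    rw [← real_inner_comm x, h.inner_eq, h.inner_eq]
    refine integral_congr_ae (ae_of_all _ fun r => ?_)
    simp only
    rw [real_inner_comm x, (hF r).inner_left_eq_inner_right]
  · rw [ContinuousLinearMap.reApplyInnerSelf_apply, RCLike.re_to_real, h.inner_eq]
    exact integral_nonneg fun r => (hF r).inner_nonneg_left x

/-- Tonelli over the countable basis; positivity lets `ENNReal.ofReal` pass through each integral.
-/
theorem traceAlong_eq_lintegral [CompleteSpace X] {ι : Type*} [Countable ι]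
    (e : HilbertBasis ι ℝ X) (h : IsStrongIntegral F S T) (hF : ∀ r, (F r).IsPositive) :
    traceAlong e T = ∫⁻ r in S, traceAlong e (F r) := by
  have hint : ∀ i, IntegrableOn (fun r => ⟪F r (e i), e i⟫_ℝ) S := fun i =>
    (h (e i)).1.inner_const _
  unfold traceAlong
  rw [lintegral_tsum fun i => (hint i).1.aemeasurable.ennreal_ofReal]
  refine tsum_congr fun i => ?_
  rw [h.inner_eq, ofReal_integral_eq_lintegral_ofReal (hint i)
    (ae_of_all _ fun r => (hF r).inner_nonneg_left _)]

end IsStrongIntegral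

/-- The operator norm of `G G*` is at most its trace. -/
theorem norm_self_comp_adjoint_le_traceAlong [CompleteSpace X] {ι : Type*}
    (e : HilbertBasis ι ℝ X) (G : X →L[ℝ] X)
    (hG : traceAlong e (G ∘L ContinuousLinearMap.adjoint G) ≠ ∞) :
    ‖G ∘L ContinuousLinearMap.adjoint G‖ ≤
      (traceAlong e (G ∘L ContinuousLinearMap.adjoint G)).toReal := by
  set τ := traceAlong e (G ∘L ContinuousLinearMap.adjoint G) with hτ
  -- Parseval and Cauchy–Schwarz: ‖G x‖² = ∑ ⟨x, G* eᵢ⟩² ≤ ‖x‖² ∑ ‖G* eᵢ‖², and the last sum is the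
  -- trace of G G*.
  have key : ∀ x, ‖G x‖ ^ 2 ≤ τ.toReal * ‖x‖ ^ 2 := fun x => by
    have h : ENNReal.ofReal (‖G x‖ ^ 2) ≤ τ * ENNReal.ofReal (‖x‖ ^ 2) := by
      rw [← tsum_ofReal_sq_inner e, hτ, traceAlong, ← ENNReal.tsum_mul_right]
      refine ENNReal.tsum_le_tsum fun i => ?_
      rw [← ENNReal.ofReal_mul' (by positivity), ContinuousLinearMap.comp_apply,
        ← ContinuousLinearMap.adjoint_inner_right, ← ContinuousLinearMap.adjoint_inner_right,
        real_inner_self_eq_norm_sq]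
      refine ENNReal.ofReal_le_ofReal ?_
      rw [← mul_pow, ← sq_abs, mul_comm]
      gcongr
      exact abs_real_inner_le_norm _ _
    have := ENNReal.toReal_mono (ENNReal.mul_ne_top hG ENNReal.ofReal_ne_top) h
    rwa [ENNReal.toReal_mul, ENNReal.toReal_ofReal (by positivity),
      ENNReal.toReal_ofReal (by positivity)] at this
  have hn : ‖G‖ ≤ √τ.toReal := G.opNorm_le_bound (by positivity) fun x => by
    refine abs_le_of_sq_le_sq' ?_ (by positivity) |>.2
    rw [mul_pow, Real.sq_sqrt ENNReal.toReal_nonneg]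
    exact key x
  calc _ ≤ ‖G‖ * ‖ContinuousLinearMap.adjoint G‖ := ContinuousLinearMap.opNorm_comp_le _ _
    _ = ‖G‖ * ‖G‖ := by rw [LinearIsometryEquiv.norm_map]
    _ ≤ √τ.toReal * √τ.toReal := by gcongr
    _ = τ.toReal := Real.mul_self_sqrt ENNReal.toReal_nonneg

/-- A measurable family `G(r) G(r)*` with integrable trace is strongly integrable. -/
theorem exists_isStrongIntegral_of_lintegral_traceAlong [CompleteSpace X]
    [TopologicalSpace.SeparableSpace X] {ι : Type*} [Countable ι]
    (e : HilbertBasis ι ℝ X) {G : ℝ → X →L[ℝ] X}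
    (hG : ∀ x, AEStronglyMeasurable (fun r => G r x) (volume.restrict S))
    (hF : ∀ r, F r = G r ∘L ContinuousLinearMap.adjoint (G r))
    (hfin : ∫⁻ r in S, traceAlong e (F r) ≠ ∞) : ∃ T, IsStrongIntegral F S T := by
  obtain rfl : F = fun r => G r ∘L ContinuousLinearMap.adjoint (G r) := funext hF
  have hm := aestronglyMeasurable_self_comp_adjoint hG
  have htm : AEMeasurable (fun r => traceAlong e (G r ∘L ContinuousLinearMap.adjoint (G r)))
      (volume.restrict S) := by
    unfold traceAlong
    exact AEMeasurable.tsum fun i =>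
      ((hm (e i)).inner aestronglyMeasurable_const).aemeasurable.ennreal_ofReal
  refine exists_isStrongIntegral_of_norm_le hm
    (integrable_toReal_of_lintegral_ne_top htm hfin) ?_
  filter_upwards [ae_lt_top' htm hfin] with r hr
  exact norm_self_comp_adjoint_le_traceAlong e (G r) hr.ne

end StrongIntegral

/-! ### The covariance operators Q(t,s) and Q(t,-∞) -/

section Covariance

open Filter Topology

variable {X : Type*} [NormedAddCommGroup X] [InnerProductSpace ℝ X]
  {U : ℝ → ℝ → X →L[ℝ] X} {B : ℝ → X →L[ℝ] X} {s t : ℝ}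

theorem IsEvolutionOperator.continuousOn_right (hU : IsEvolutionOperator U) (t : ℝ) (x : X) :
    ContinuousOn (fun r => U t r x) (Iic t) :=
  (hU.strong_cont x).comp (f := fun r => (r, t)) (by fun_prop) fun _ hr => hr

variable [CompleteSpace X]

/-- The form G G* yields positivity, weak measurability and the bound of the norm by the trace. -/
theorem covIntegrand_eq (U : ℝ → ℝ → X →L[ℝ] X) (B : ℝ → X →L[ℝ] X) (t r : ℝ) :
    covIntegrand U B t r =
      (U t r ∘L B r) ∘L ContinuousLinearMap.adjoint (U t r ∘L B r) := by
  rw [ContinuousLinearMap.adjoint_comp]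
  rfl

theorem covIntegrand_isPositive (U : ℝ → ℝ → X →L[ℝ] X) (B : ℝ → X →L[ℝ] X) (t r : ℝ) :
    (covIntegrand U B t r).IsPositive :=
  covIntegrand_eq U B t r ▸ ContinuousLinearMap.isPositive_self_comp_adjoint _

namespace IsEvolutionOperator

theorem covIntegrand_eq_conj (hU : IsEvolutionOperator U) (B : ℝ → X →L[ℝ] X) {r : ℝ}
    (hrs : r ≤ s) (hst : s ≤ t) :
    U t s ∘L covIntegrand U B s r ∘L ContinuousLinearMap.adjoint (U t s) =
      covIntegrand U B t r := by
  rw [covIntegrand_eq, covIntegrand_eq, ← hU.comp r s t hrs hst]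
  simp only [ContinuousLinearMap.adjoint_comp, ContinuousLinearMap.comp_assoc]

end IsEvolutionOperator

/-- The shift n + 1 keeps the left endpoint strictly below t already for n = 0, as the trace
hypotheses require. -/
theorem iUnion_Ioc_sub_natCast (t : ℝ) : ⋃ n : ℕ, Ioc (t - (n + 1)) t = Iic t := by
  ext r
  simp only [mem_iUnion, mem_Ioc, mem_Iic, exists_and_right, and_iff_right_iff_imp]
  intro _
  obtain ⟨n, hn⟩ := exists_nat_gt (t - r)
  exact ⟨n, by linarith⟩

theorem monotone_Ioc_sub_natCast (t : ℝ) : Monotone fun n : ℕ => Ioc (t - (n + 1)) t :=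
  fun m n hmn => Ioc_subset_Ioc_left (by
    have : (m : ℝ) ≤ n := by exact_mod_cast hmn
    linarith)

namespace OUHypothesis

theorem exists_norm_covIntegrand_le (h : OUHypothesis U B) (s t : ℝ) :
    ∃ C, ∀ r ∈ Ioc s t, ‖covIntegrand U B t r‖ ≤ C := by
  obtain ⟨M, hM, ζ, hU⟩ := h.evolution.exp_bound
  obtain ⟨K, hK, hB⟩ := h.bounded
  refine ⟨(M * Real.exp (|ζ| * (t - s)) * K) * (M * Real.exp (|ζ| * (t - s)) * K), ?_⟩
  intro r hr
  -- The sign of ζ is arbitrary; |ζ| gives a bound uniform in r.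
  have hexp : ‖U t r‖ ≤ M * Real.exp (|ζ| * (t - s)) := by
    refine (hU r t hr.2).trans ?_
    refine mul_le_mul_of_nonneg_left (Real.exp_le_exp.2 ?_) hM.le
    nlinarith [neg_le_abs ζ, abs_nonneg ζ, hr.1, hr.2]
  have hG : ‖U t r ∘L B r‖ ≤ M * Real.exp (|ζ| * (t - s)) * K :=
    (ContinuousLinearMap.opNorm_comp_le _ _).trans (by gcongr; exact hB r)
  rw [covIntegrand_eq]
  refine (ContinuousLinearMap.opNorm_comp_le _ _).trans ?_
  rw [LinearIsometryEquiv.norm_map]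
  gcongr

variable [TopologicalSpace.SeparableSpace X]

theorem aestronglyMeasurable_comp (h : OUHypothesis U B) {S : Set ℝ} (hS : S ⊆ Iic t)
    (x : X) : AEStronglyMeasurable (fun r => (U t r ∘L B r) x) (volume.restrict S) :=
  (aestronglyMeasurable_apply_apply
    (fun y => (h.evolution.continuousOn_right t y).aestronglyMeasurable measurableSet_Iic)
    (h.strong_cont x).aestronglyMeasurable).mono_measure (Measure.restrict_mono hS le_rfl)

/-- Certifies that the default value 0 in `strongIntegral` is not what defines `covOp`. For t ≤ s
the interval is empty. -/
theorem isStrongIntegral_covOp (h : OUHypothesis U B) (s t : ℝ) :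
    IsStrongIntegral (covIntegrand U B t) (Ioc s t) (covOp U B t s) := by
  obtain ⟨C, hC⟩ := h.exists_norm_covIntegrand_le s t
  have hm : ∀ x, AEStronglyMeasurable (fun r => covIntegrand U B t r x)
      (volume.restrict (Ioc s t)) := fun x => by
    simp only [covIntegrand_eq]
    exact aestronglyMeasurable_self_comp_adjoint
      (h.aestronglyMeasurable_comp fun r hr => hr.2) x
  obtain ⟨T, hT⟩ := exists_isStrongIntegral_of_norm_le hm (g := fun _ => C)
    (integrableOn_const (by simp)) (ae_restrict_of_forall_mem measurableSet_Ioc hC)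
  rw [covOp, hT.strongIntegral_eq]
  exact hT

theorem covOp_isPositive (h : OUHypothesis U B) (s t : ℝ) : (covOp U B t s).IsPositive :=
  (h.isStrongIntegral_covOp s t).isPositive (covIntegrand_isPositive U B t)

/-- Monotone convergence along the intervals (t - (n + 1), t], on each of which the integral is the
trace of some Q(t,s) with s < t. -/
theorem lintegral_traceAlong_lt_top (h : OUHypothesis U B) {ι : Type*} [Countable ι]
    (e : HilbertBasis ι ℝ X)
    (hsup : (⨆ s : Iio t, opTrace (covOp U B t s)) < ∞) :
    ∫⁻ r in Iic t, traceAlong e (covIntegrand U B t r) < ∞ := by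
  refine lt_of_le_of_lt ?_ hsup
  rw [← iUnion_Ioc_sub_natCast, setLIntegral_iUnion_of_directed _
    (monotone_Ioc_sub_natCast t).directed_le]
  refine iSup_le fun n => ?_
  rw [← (h.isStrongIntegral_covOp _ t).traceAlong_eq_lintegral e (covIntegrand_isPositive U B t),
    ← opTrace_eq_traceAlong e (h.covOp_isPositive _ t)]
  exact le_iSup (fun s : Iio t => opTrace (covOp U B t s))
    ⟨t - (n + 1), by simp only [mem_Iio]; linarith [(n.cast_nonneg : (0 : ℝ) ≤ n)]⟩

theorem isStrongIntegral_covOpInf (h : OUHypothesis U B)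
    (hsup : (⨆ s : Iio t, opTrace (covOp U B t s)) < ∞) :
    IsStrongIntegral (covIntegrand U B t) (Iic t) (covOpInf U B t) := by
  obtain ⟨w, e, -⟩ := exists_hilbertBasis ℝ X
  have := e.countable
  obtain ⟨T, hT⟩ := exists_isStrongIntegral_of_lintegral_traceAlong e
    (h.aestronglyMeasurable_comp subset_rfl) (covIntegrand_eq U B t)
    (h.lintegral_traceAlong_lt_top e hsup).ne
  rw [covOpInf, hT.strongIntegral_eq]
  exact hT

theorem covOpInf_isPositive (h : OUHypothesis U B)
    (hsup : (⨆ s : Iio t, opTrace (covOp U B t s)) < ∞) : (covOpInf U B t).IsPositive :=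
  (h.isStrongIntegral_covOpInf hsup).isPositive (covIntegrand_isPositive U B t)

theorem opTrace_covOpInf_lt_top (h : OUHypothesis U B)
    (hsup : (⨆ s : Iio t, opTrace (covOp U B t s)) < ∞) : opTrace (covOpInf U B t) < ∞ := by
  obtain ⟨w, e, -⟩ := exists_hilbertBasis ℝ X
  have := e.countable
  rw [opTrace_eq_traceAlong e (h.covOpInf_isPositive hsup),
    (h.isStrongIntegral_covOpInf hsup).traceAlong_eq_lintegral e (covIntegrand_isPositive U B t)]
  exact h.lintegral_traceAlong_lt_top e hsup

/-- `Q(t,-∞) = U(t,s) Q(s,-∞) U(t,s)* + Q(t,s)`. -/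
theorem covOpInf_eq_add (h : OUHypothesis U B)
    (hsup : ∀ t, (⨆ s : Iio t, opTrace (covOp U B t s)) < ∞) (hst : s ≤ t) :
    covOpInf U B t =
      U t s ∘L covOpInf U B s ∘L ContinuousLinearMap.adjoint (U t s) + covOp U B t s := by
  have h₁ := ((h.isStrongIntegral_covOpInf (hsup s)).comp (U t s)
    (ContinuousLinearMap.adjoint (U t s))).congr measurableSet_Iic
    fun r hr => h.evolution.covIntegrand_eq_conj B hr hst
  have h₂ := h₁.union (h.isStrongIntegral_covOp s t)
    (Iic_disjoint_Ioc le_rfl) measurableSet_Ioc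
  rw [Iic_union_Ioc_eq_Iic hst] at h₂
  exact (h.isStrongIntegral_covOpInf (hsup t)).unique h₂

theorem tendsto_inner_covOp (h : OUHypothesis U B)
    (hsup : (⨆ s : Iio t, opTrace (covOp U B t s)) < ∞) (x y : X) :
    Tendsto (fun n : ℕ => ⟪covOp U B t (t - (n + 1)) x, y⟫_ℝ) atTop
      (𝓝 ⟪covOpInf U B t x, y⟫_ℝ) := by
  have hint := ((h.isStrongIntegral_covOpInf hsup) x).1.inner_const (𝕜 := ℝ) y
  simp only [(h.isStrongIntegral_covOpInf hsup).inner_eq,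
    (h.isStrongIntegral_covOp _ t).inner_eq]
  have := tendsto_setIntegral_of_monotone (μ := volume)
    (f := fun r => ⟪covIntegrand U B t r x, y⟫_ℝ) (fun n : ℕ => measurableSet_Ioc)
    (monotone_Ioc_sub_natCast t)
  rw [iUnion_Ioc_sub_natCast] at this
  exact this hint

end OUHypothesis

end Covariance

/-! ### Centred Gaussian laws: translation and symmetry -/

section GaussianLaw

variable {X : Type*} [NormedAddCommGroup X] [InnerProductSpace ℝ X] [MeasurableSpace X]
  {T : X →L[ℝ] X}

theorem IsGaussianLaw.charFun_zero_mean {μ : Measure X} (h : IsGaussianLaw μ 0 T) (x : X) :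
    charFun μ x = Complex.exp (-(⟪T x, x⟫_ℝ : ℂ) / 2) := by
  rw [h.2]
  simp [neg_div]

variable [BorelSpace X] [SecondCountableTopology X] [CompleteSpace X]

theorem charFun_map_clm (μ : Measure X) (A : X →L[ℝ] X) (h : X) :
    charFun (μ.map A) h = charFun μ (ContinuousLinearMap.adjoint A h) := by
  rw [charFun_apply, charFun_apply, integral_map (by fun_prop) (by fun_prop)]
  simp only [ContinuousLinearMap.adjoint_inner_right]

theorem isGaussianLaw_gaussianLaw_zero (hT : T.IsPositive) (htr : opTrace T < ∞) :
    IsGaussianLaw (gaussianLaw 0 T) 0 T := by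
  obtain ⟨μ, hμ⟩ := exists_isGaussianLaw_zero hT htr
  rwa [hμ.gaussianLaw_eq]

theorem gaussianLaw_eq_map (hT : T.IsPositive) (htr : opTrace T < ∞) (m : X) :
    gaussianLaw m T = (gaussianLaw 0 T).map (m + ·) :=
  ((isGaussianLaw_gaussianLaw_zero hT htr).map_const_add m).gaussianLaw_eq

/-- The characteristic function is even because the covariance form is quadratic. -/
theorem IsGaussianLaw.map_neg {μ : Measure X} (h : IsGaussianLaw μ 0 T) :
    μ.map (fun x => -x) = μ := by
  have := h.1
  have : IsProbabilityMeasure (μ.map fun x => -x) :=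
    Measure.isProbabilityMeasure_map (by fun_prop)
  refine Measure.ext_of_charFun (funext fun x => ?_)
  have h1 : charFun (μ.map fun x => -x) x = charFun μ (-x) := by
    simpa using charFun_map_smul (μ := μ) (-1) x
  rw [h1, h.charFun_zero_mean, h.charFun_zero_mean, _root_.map_neg, inner_neg_neg]

end GaussianLaw

/-! ### Evolution systems as convolution and characteristic function identities -/

section EvolutionSystems

open Filter Topology

variable {X : Type*} [NormedAddCommGroup X] [InnerProductSpace ℝ X] [CompleteSpace X]
  [TopologicalSpace.SeparableSpace X] [MeasurableSpace X] [BorelSpace X]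
  {U : ℝ → ℝ → X →L[ℝ] X} {B : ℝ → X →L[ℝ] X} {s t : ℝ}

theorem isEvolutionSystem_flowEvolution_iff {μ : ℝ → Measure X} :
    IsEvolutionSystem (flowEvolution U) μ ↔
      (∀ t, IsProbabilityMeasure (μ t)) ∧ ∀ s t, s ≤ t → ∀ h,
        charFun (μ t) h = charFun (μ s) (ContinuousLinearMap.adjoint (U t s) h) := by
  have : SecondCountableTopology X := UniformSpace.secondCountable_of_separable X
  refine and_congr_right fun hμ => forall₃_congr fun s t _ => ?_
  have : IsProbabilityMeasure ((μ s).map (U t s)) :=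
    Measure.isProbabilityMeasure_map (by fun_prop)
  have hmap : ∀ φ : X →ᵇ ℝ, ∫ x, flowEvolution U s t φ x ∂μ s = ∫ x, φ x ∂(μ s).map (U t s) :=
    fun φ => by
      rw [integral_map (by fun_prop) φ.continuous.aestronglyMeasurable]
      rfl
  simp only [hmap, ← charFun_map_clm]
  constructor
  · intro h x
    rw [ext_of_forall_integral_eq_of_IsFiniteMeasure h]
  · intro h φ
    rw [Measure.ext_of_charFun (funext h)]

namespace OUHypothesis

theorem isGaussianLaw_covOp (h : OUHypothesis U B) (hst : s < t) :
    IsGaussianLaw (gaussianLaw 0 (covOp U B t s)) 0 (covOp U B t s) := by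
  have : SecondCountableTopology X := UniformSpace.secondCountable_of_separable X
  exact isGaussianLaw_gaussianLaw_zero (h.covOp_isPositive s t) (h.finite_trace s t hst)

theorem isGaussianLaw_ouGaussian (h : OUHypothesis U B)
    (hsup : (⨆ s : Iio t, opTrace (covOp U B t s)) < ∞) :
    IsGaussianLaw (ouGaussian U B t) 0 (covOpInf U B t) := by
  have : SecondCountableTopology X := UniformSpace.secondCountable_of_separable X
  exact isGaussianLaw_gaussianLaw_zero (h.covOpInf_isPositive hsup)
    (h.opTrace_covOpInf_lt_top hsup)

/-- N(m, Q) is the translate of N(0, Q) by m, so averaging over m = U(t,s)x with x distributed as ν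
is a convolution. -/
theorem integral_ouEvolution (h : OUHypothesis U B) (hst : s < t) (ν : Measure X)
    [IsProbabilityMeasure ν] (φ : X →ᵇ ℝ) :
    ∫ x, ouEvolution U B s t φ x ∂ν =
      ∫ x, φ x ∂(gaussianLaw 0 (covOp U B t s)).conv (ν.map (U t s)) := by
  have : SecondCountableTopology X := UniformSpace.secondCountable_of_separable X
  have := (h.isGaussianLaw_covOp hst).1
  have : IsProbabilityMeasure (ν.map (U t s)) := Measure.isProbabilityMeasure_map (by fun_prop)
  have hφ : ∀ κ : Measure X, AEStronglyMeasurable φ κ := fun κ =>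
    φ.continuous.aestronglyMeasurable
  rw [Measure.conv_comm, integral_conv (φ.integrable _), integral_map (by fun_prop)]
  · refine integral_congr_ae (ae_of_all _ fun x => ?_)
    simp only [ouEvolution, if_neg hst.ne]
    rw [gaussianLaw_eq_map (h.covOp_isPositive s t) (h.finite_trace s t hst),
      integral_map (by fun_prop) (hφ _)]
  · exact (StronglyMeasurable.integral_prod_right'
      (f := fun p : X × X => φ (p.1 + p.2))
      (φ.continuous.comp (by fun_prop)).stronglyMeasurable).aestronglyMeasurable

theorem isEvolutionSystem_ouEvolution_iff (h : OUHypothesis U B) {ν : ℝ → Measure X} :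
    IsEvolutionSystem (ouEvolution U B) ν ↔
      (∀ t, IsProbabilityMeasure (ν t)) ∧ ∀ s t, s < t →
        ν t = (gaussianLaw 0 (covOp U B t s)).conv ((ν s).map (U t s)) := by
  have : SecondCountableTopology X := UniformSpace.secondCountable_of_separable X
  refine and_congr_right fun hν => ⟨fun hev s t hst => ?_, fun hev s t hst φ => ?_⟩
  · have := (h.isGaussianLaw_covOp hst).1
    have : IsProbabilityMeasure ((ν s).map (U t s)) :=
      Measure.isProbabilityMeasure_map (by fun_prop)
    refine (ext_of_forall_integral_eq_of_IsFiniteMeasure fun φ => ?_).symm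
    rw [← h.integral_ouEvolution hst, hev s t hst.le φ]
  · obtain rfl | hst := hst.eq_or_lt
    · simp [ouEvolution]
    · rw [h.integral_ouEvolution hst, ← hev s t hst]

theorem isEvolutionSystem_ouEvolution_iff_charFun (h : OUHypothesis U B) {ν : ℝ → Measure X} :
    IsEvolutionSystem (ouEvolution U B) ν ↔
      (∀ t, IsProbabilityMeasure (ν t)) ∧ ∀ s t, s < t → ∀ x,
        charFun (ν t) x = Complex.exp (-(⟪covOp U B t s x, x⟫_ℝ : ℂ) / 2) *
          charFun (ν s) (ContinuousLinearMap.adjoint (U t s) x) := by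
  have : SecondCountableTopology X := UniformSpace.secondCountable_of_separable X
  rw [h.isEvolutionSystem_ouEvolution_iff]
  refine and_congr_right fun hν => forall₃_congr fun s t hst => ?_
  have hκ := h.isGaussianLaw_covOp hst
  have := hκ.1
  have : IsProbabilityMeasure ((ν s).map (U t s)) :=
    Measure.isProbabilityMeasure_map (by fun_prop)
  have hchar : ∀ x, charFun ((gaussianLaw 0 (covOp U B t s)).conv ((ν s).map (U t s))) x =
      Complex.exp (-(⟪covOp U B t s x, x⟫_ℝ : ℂ) / 2) *
        charFun (ν s) (ContinuousLinearMap.adjoint (U t s) x) := fun x => by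
    rw [charFun_conv, hκ.charFun_zero_mean, charFun_map_clm]
  simp only [← hchar]
  exact ⟨fun heq x => by rw [← heq], fun heq => Measure.ext_of_charFun (funext heq)⟩

/-- The cocycle identity for Q(t,-∞), exponentiated. -/
theorem charFun_ouGaussian_eq (h : OUHypothesis U B)
    (hsup : ∀ t : ℝ, (⨆ s : Iio t, opTrace (covOp U B t s)) < ∞) (hst : s ≤ t) (x : X) :
    charFun (ouGaussian U B t) x = Complex.exp (-(⟪covOp U B t s x, x⟫_ℝ : ℂ) / 2) *
      charFun (ouGaussian U B s) (ContinuousLinearMap.adjoint (U t s) x) := by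
  have : SecondCountableTopology X := UniformSpace.secondCountable_of_separable X
  rw [(h.isGaussianLaw_ouGaussian (hsup t)).charFun_zero_mean,
    (h.isGaussianLaw_ouGaussian (hsup s)).charFun_zero_mean, ← Complex.exp_add,
    h.covOpInf_eq_add hsup hst]
  congr 1
  rw [add_apply, inner_add_left, ContinuousLinearMap.comp_apply,
    ContinuousLinearMap.comp_apply, ← ContinuousLinearMap.adjoint_inner_right]
  push_cast
  ring

theorem isEvolutionSystem_ouGaussian (h : OUHypothesis U B)
    (hsup : ∀ t : ℝ, (⨆ s : Iio t, opTrace (covOp U B t s)) < ∞) :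
    IsEvolutionSystem (ouEvolution U B) (ouGaussian U B) :=
  h.isEvolutionSystem_ouEvolution_iff_charFun.2
    ⟨fun t => (h.isGaussianLaw_ouGaussian (hsup t)).1,
      fun _ _ hst x => h.charFun_ouGaussian_eq hsup hst.le x⟩

theorem isEvolutionSystem_conv (h : OUHypothesis U B)
    (hsup : ∀ t : ℝ, (⨆ s : Iio t, opTrace (covOp U B t s)) < ∞) {μ : ℝ → Measure X}
    (hμ : IsEvolutionSystem (flowEvolution U) μ) :
    IsEvolutionSystem (ouEvolution U B) fun t => (ouGaussian U B t).conv (μ t) := by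
  have : SecondCountableTopology X := UniformSpace.secondCountable_of_separable X
  rw [isEvolutionSystem_flowEvolution_iff] at hμ
  have := hμ.1
  have := fun t => (h.isGaussianLaw_ouGaussian (hsup t)).1
  refine h.isEvolutionSystem_ouEvolution_iff_charFun.2
    ⟨fun t => inferInstance, fun s t hst x => ?_⟩
  rw [charFun_conv, charFun_conv, h.charFun_ouGaussian_eq hsup hst.le, hμ.2 s t hst.le, mul_assoc]

/-- For an evolution system `ν`, the measures `U(t, s) ν_s`, `s → -∞`, are tight. -/
theorem isTightMeasureSet_map (h : OUHypothesis U B)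
    (hsup : ∀ t : ℝ, (⨆ s : Iio t, opTrace (covOp U B t s)) < ∞) {ν : ℝ → Measure X}
    (hν : IsEvolutionSystem (ouEvolution U B) ν) (t : ℝ) :
    IsTightMeasureSet (range fun n : ℕ => (ν (t - (n + 1))).map (U t (t - (n + 1)))) := by
  have : SecondCountableTopology X := UniformSpace.secondCountable_of_separable X
  have hlt : ∀ n : ℕ, t - (n + 1) < t := fun n => by linarith [(n.cast_nonneg : (0 : ℝ) ≤ n)]
  have := fun n => (h.isGaussianLaw_covOp (hlt n)).1
  have hmap : ∀ ν : ℝ → Measure X, IsEvolutionSystem (ouEvolution U B) ν →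
      (∀ n : ℕ, IsProbabilityMeasure ((ν (t - (n + 1))).map (U t (t - (n + 1))))) ∧
      IsTightMeasureSet (range fun n : ℕ => (gaussianLaw 0 (covOp U B t (t - (n + 1)))).conv
        ((ν (t - (n + 1))).map (U t (t - (n + 1))))) := fun ν hν => by
    rw [h.isEvolutionSystem_ouEvolution_iff] at hν
    have := hν.1
    refine ⟨fun n => Measure.isProbabilityMeasure_map (by fun_prop), ?_⟩
    -- Every convolution equals ν_t, so the family is a single measure, which is tight.
    simp only [← hν.2 _ t (hlt _), range_const]
    exact isTightMeasureSet_singleton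
  -- Applied to γ itself, this yields tightness of the symmetric left factors N(0, Q(t,s)); applied
  -- to ν, it then yields that of the right factors.
  obtain ⟨_, hγ⟩ := hmap _ (h.isEvolutionSystem_ouGaussian hsup)
  obtain ⟨_, hν⟩ := hmap _ hν
  exact isTightMeasureSet_range_right_of_conv (isTightMeasureSet_range_left_of_conv_of_symm
    (fun n => (h.isGaussianLaw_covOp (hlt n)).map_neg) hγ) hν

/-- The factor μ_t is forced to have characteristic function ν̂_t/γ̂_t; tightness makes this
quotient a characteristic function. -/
theorem exists_eq_conv (h : OUHypothesis U B)
    (hsup : ∀ t : ℝ, (⨆ s : Iio t, opTrace (covOp U B t s)) < ∞) {ν : ℝ → Measure X}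
    (hν : IsEvolutionSystem (ouEvolution U B) ν) :
    ∃ μ : ℝ → Measure X, IsEvolutionSystem (flowEvolution U) μ ∧
      ∀ t, ν t = (ouGaussian U B t).conv (μ t) := by
  have : SecondCountableTopology X := UniformSpace.secondCountable_of_separable X
  have hlt : ∀ (t : ℝ) (n : ℕ), t - (n + 1) < t := fun t n => by
    linarith [(n.cast_nonneg : (0 : ℝ) ≤ n)]
  have hchar := h.isEvolutionSystem_ouEvolution_iff_charFun.1 hν
  have := hchar.1
  have hγ := fun t => (h.isGaussianLaw_ouGaussian (hsup t)).1
  have hγ0 : ∀ t x, charFun (ouGaussian U B t) x ≠ 0 := fun t x => by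
    rw [(h.isGaussianLaw_ouGaussian (hsup t)).charFun_zero_mean]
    exact Complex.exp_ne_zero _
  have hlim : ∀ t x, Tendsto
      (fun n : ℕ => charFun ((ν (t - (n + 1))).map (U t (t - (n + 1)))) x) atTop
      (𝓝 (charFun (ν t) x / charFun (ouGaussian U B t) x)) := fun t x => by
    have hexp : Tendsto (fun n : ℕ =>
        Complex.exp (-(⟪covOp U B t (t - (n + 1)) x, x⟫_ℝ : ℂ) / 2)) atTop
        (𝓝 (charFun (ouGaussian U B t) x)) := by
      rw [(h.isGaussianLaw_ouGaussian (hsup t)).charFun_zero_mean]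
      have hc : Continuous fun a : ℝ => Complex.exp (-(a : ℂ) / 2) := by fun_prop
      exact (hc.tendsto _).comp (h.tendsto_inner_covOp (hsup t) x x)
    -- For each n the evolution relation writes the characteristic function exactly as ν̂_t divided
    -- by that of N(0, Q(t,s)); only the denominator varies.
    refine (tendsto_const_nhds.div hexp (hγ0 t x)).congr fun n => ?_
    rw [Pi.div_apply, charFun_map_clm, hchar.2 _ t (hlt t n),
      mul_div_cancel_left₀ _ (Complex.exp_ne_zero _)]
  have hex : ∀ t, ∃ μ : Measure X, IsProbabilityMeasure μ ∧
      ∀ x, charFun μ x = charFun (ν t) x / charFun (ouGaussian U B t) x := fun t => by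
    have : ∀ n : ℕ, IsProbabilityMeasure ((ν (t - (n + 1))).map (U t (t - (n + 1)))) := fun n =>
      Measure.isProbabilityMeasure_map (by fun_prop)
    exact exists_charFun_eq_of_isTightMeasureSet (h.isTightMeasureSet_map hsup hν t) (hlim t)
  choose μ hμ hμchar using hex
  refine ⟨μ, isEvolutionSystem_flowEvolution_iff.2 ⟨hμ, fun s t hst x => ?_⟩, fun t => ?_⟩
  · obtain rfl | hst := hst.eq_or_lt
    · rw [h.evolution.self, ContinuousLinearMap.adjoint_id, ContinuousLinearMap.id_apply]
    -- The Gaussian factor of N(0, Q(t,s)) occurs in both ν̂_t and γ̂_t and cancels in the quotient.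
    · rw [hμchar, hμchar, hchar.2 s t hst, h.charFun_ouGaussian_eq hsup hst.le,
        mul_div_mul_left _ _ (Complex.exp_ne_zero _)]
  · refine Measure.ext_of_charFun (funext fun x => ?_)
    rw [charFun_conv, hμchar, mul_div_cancel₀ _ (hγ0 t x)]

end OUHypothesis

end EvolutionSystems

theorem theorem5p5 {X : Type*} [NormedAddCommGroup X] [InnerProductSpace ℝ X] [CompleteSpace X]
    [TopologicalSpace.SeparableSpace X] [MeasurableSpace X] [BorelSpace X]
    (U : ℝ → ℝ → X →L[ℝ] X) (B : ℝ → X →L[ℝ] X) (hUB : OUHypothesis U B)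
    (hsup : ∀ t : ℝ, (⨆ s : Set.Iio t, opTrace (covOp U B t s)) < ∞) :
    (∀ t, IsStrongIntegral (covIntegrand U B t) (Set.Iic t) (covOpInf U B t) ∧
      (covOpInf U B t).IsPositive ∧ opTrace (covOpInf U B t) < ∞) ∧
    IsEvolutionSystem (ouEvolution U B) (ouGaussian U B) ∧
    ∀ ν : ℝ → Measure X, IsEvolutionSystem (ouEvolution U B) ν ↔
      ∃ μ : ℝ → Measure X, IsEvolutionSystem (flowEvolution U) μ ∧
        ∀ t, ν t = (ouGaussian U B t).conv (μ t) := by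
  refine ⟨fun t => ⟨hUB.isStrongIntegral_covOpInf (hsup t), hUB.covOpInf_isPositive (hsup t),
    hUB.opTrace_covOpInf_lt_top (hsup t)⟩, hUB.isEvolutionSystem_ouGaussian hsup, fun ν =>
    ⟨hUB.exists_eq_conv hsup, ?_⟩⟩
  rintro ⟨μ, hμ, hν⟩
  rw [show ν = fun t => (ouGaussian U B t).conv (μ t) from funext hν]
  exact hUB.isEvolutionSystem_conv hsup hμ
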